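/- All ordinal arithmetic is in the ordinal sense, and an ordinal (identified with the set of smaller ordinals) carries its order topology. For a set $X$, let $[X]^2$ be the set of its $2$-element subsets. For ordinals $\delta,\gamma_0,\gamma_1$, we write $\delta\to(\gamma_0,\gamma_1)^2$ [respectively $\delta\to_{top}(\gamma_0,\gamma_1)^2$, $\delta\to_{cl}(\gamma_0,\gamma_1)^2$] if for every function $c:[\delta]^2\to\{0,1\}$ there are $X\subseteq\delta$ and $i\in\{0,1\}$ such that $c$ takes only the value $i$ on $[X]^2$ and $X$, with the order and the subspace topology inherited from $\delta$, is order-isomorphic to $\gamma_i$ [respectively homeomorphic to $\gamma_i$; admits a bijection onto $\gamma_i$ that is both an order-isomorphism and a homeomorphism]. Let $R(\gamma_0,\gamma_1)$ be the least ordinal $\delta$ with $\delta\to(\gamma_0,\gamma_1)^2$. Let $\alpha$ and $\beta$ be countable nonzero ordinals, let $m\ge 0$ be an integer, and let $k>1$ be an integer. If $$\omega^{\omega^\alpha}\to_{cl}(\omega^\beta\cdot m+1,k)^2,$$ then $$\omega^{\omega^\alpha\cdot\beta}\cdot R(m,k+1)+1\to_{top}(\omega^\beta\cdot m+1,k+1)^2.$$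 -/

import Mathlib

open Set Ordinal

universe u v

/-- The coloring `c` of the `n`-element subsets of the ordinal `b = {x | x < b}` is constantly `i`
on the `n`-element subsets of `X`. -/
def OrdHomogeneous {b : Ordinal.{u}} {n : ℕ} {ι : Type v}
    (c : Set.powersetCard (Iio b) n → ι) (X : Set (Iio b)) (i : ι) : Prop :=
  ∀ s : Set.powersetCard (Iio b) n, (∀ x ∈ (s : Finset (Iio b)), x ∈ X) → c s = i

/-- The classical partition relation `b → (a i)ⁿ`, with `i` ranging over the colors `ι`. -/
def OrdArrow {ι : Type v} (n : ℕ) (b : Ordinal.{u}) (a : ι → Ordinal.{u}) : Prop :=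
  ∀ c : Set.powersetCard (Iio b) n → ι, ∃ (X : Set (Iio b)) (i : ι),
    OrdHomogeneous c X i ∧ Nonempty (X ≃o Iio (a i))

/-- The topological partition relation `b →_top (a i)ⁿ`: the homogeneous set, with the subspace
topology, is homeomorphic to `a i`. An initial segment `Iio a` of the ordinals carries its order
topology, which agrees with the subspace topology from `Ordinal`. -/
def OrdArrowTop {ι : Type v} (n : ℕ) (b : Ordinal.{u}) (a : ι → Ordinal.{u}) : Prop :=
  ∀ c : Set.powersetCard (Iio b) n → ι, ∃ (X : Set (Iio b)) (i : ι),
    OrdHomogeneous c X i ∧ Nonempty (X ≃ₜ Iio (a i))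

/-- The closed partition relation `b →_cl (a i)ⁿ`: the homogeneous set is order-homeomorphic
to `a i`, that is, one bijection is both an order isomorphism and a homeomorphism. -/
def OrdArrowCl {ι : Type v} (n : ℕ) (b : Ordinal.{u}) (a : ι → Ordinal.{u}) : Prop :=
  ∀ c : Set.powersetCard (Iio b) n → ι, ∃ (X : Set (Iio b)) (i : ι),
    OrdHomogeneous c X i ∧ ∃ e : X ≃o Iio (a i), IsHomeomorph e

/-- The classical ordinal Ramsey number: the least `b` with `b → (a i)²`. -/
noncomputable def ordRamsey {ι : Type v} (a : ι → Ordinal.{u}) : Ordinal.{u} :=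
  sInf {b : Ordinal.{u} | OrdArrow 2 b a}

/-! Suppose color 1 has no clique of size `k + 1` and color 0 no homogeneous copy of `ω ^ β * m +
1`. Size is measured by Cantor–Bendixson rank. If the color-1 neighbourhood of a point `z` contained
points of every rank below `ω ^ α`, it would contain a closed copy of `ω ^ ω ^ α`
(`exists_isClosedCopy_of_not_cbRankLT`). The hypothesis, applied inside that copy, gives a forbidden
color-0 set or a color-1 clique of size `k`, which `z` completes to a forbidden one. So every
color-1 neighbourhood has rank below `ω ^ α`.

The rank of a union is controlled by the natural sum (`mem_cbDeriv_natSum`), and an ordinal below `ω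
^ α * r` stays below it after natural addition of something less than `ω ^ α`. Hence deleting
finitely many neighbourhoods loses no point of a derivative of order `ω ^ α * r`
(`cbDeriv_subset_diff`).

The Ramsey number yields `m` points with pairwise color 0 among multiples of `ω ^ (ω ^ α * β)`,
which have rank at least `ω ^ α * β`. Finite approximations build a color-0 homogeneous `Y` around
them in which rank `ω ^ α * r` becomes rank `r` (`exists_superset_cbDeriv`). The `m` points then
have rank `β` in `Y`, and stacking closed copies of `ω ^ β` that end at them gives the forbidden
color-0 set. -/

/-! ### Natural sums and powers of `ω` -/

/-- The natural (Hessenberg) sum of two ordinals. -/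
noncomputable def Ordinal.natSum (a b : Ordinal.{u}) : Ordinal.{u} :=
  sInf {c | (∀ a', ∀ _ : a' < a, natSum a' b < c) ∧ (∀ b', ∀ _ : b' < b, natSum a b' < c)}
termination_by (a, b)

namespace Ordinal

theorem natSum_spec (a b : Ordinal.{u}) :
    (∀ a' < a, natSum a' b < natSum a b) ∧ (∀ b' < b, natSum a b' < natSum a b) := by
  have hne : {c | (∀ a', ∀ _ : a' < a, natSum a' b < c) ∧
      (∀ b', ∀ _ : b' < b, natSum a b' < c)}.Nonempty := by
    obtain ⟨c, hc⟩ := bddAbove_of_small (s := (fun a' => natSum a' b) '' Iio a)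
    obtain ⟨d, hd⟩ := bddAbove_of_small (s := (fun b' => natSum a b') '' Iio b)
    refine ⟨Order.succ (max c d), fun a' h => ?_, fun b' h => ?_⟩
    · exact Order.lt_succ_of_le ((hc (mem_image_of_mem _ h)).trans (le_max_left _ _))
    · exact Order.lt_succ_of_le ((hd (mem_image_of_mem _ h)).trans (le_max_right _ _))
  have := csInf_mem hne
  rw [← natSum] at this
  exact this

theorem natSum_lt_left {a' a b : Ordinal.{u}} (h : a' < a) : natSum a' b < natSum a b :=
  (natSum_spec a b).1 a' h

theorem natSum_lt_right {a b' b : Ordinal.{u}} (h : b' < b) : natSum a b' < natSum a b :=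
  (natSum_spec a b).2 b' h

theorem natSum_le {a b c : Ordinal.{u}} (h₁ : ∀ a' < a, natSum a' b < c)
    (h₂ : ∀ b' < b, natSum a b' < c) : natSum a b ≤ c := by
  rw [natSum]
  exact csInf_le' ⟨h₁, h₂⟩

theorem exists_eq_mul_add {w c p a : Ordinal.{u}} (hw : w ≠ 0) (h : c < w * p + a) (ha : a < w) :
    ∃ p' a', c = w * p' + a' ∧ a' < w ∧ (p' < p ∨ p' = p ∧ a' < a) := by
  refine ⟨c / w, c % w, (Ordinal.div_add_mod c w).symm, Ordinal.mod_lt c hw, ?_⟩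
  rcases lt_trichotomy (c / w) p with h' | h' | h'
  · exact Or.inl h'
  · refine Or.inr ⟨h', ?_⟩
    rw [← Ordinal.div_add_mod c w, h'] at h
    exact (add_lt_add_iff_left _).1 h
  · exfalso
    have h1 : w * (p + 1) ≤ w * (c / w) := by
      gcongr
      exact Order.add_one_le_of_lt h'
    have h2 : w * p + a < w * (p + 1) := by
      rw [mul_add_one]; gcongr
    exact absurd ((h.trans h2).trans_le h1) (not_lt.2 (Ordinal.mul_div_le c w))

/-- Lowering `p` or `q` frees a whole block `ω ^ γ`, which by `hγ` absorbs the natural sum of the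
remainders; lowering a remainder is strict monotonicity. Finiteness of `q` gives `1 + q = q + 1`,
needed when `p` drops. -/
theorem natSum_mul_add_le {γ : Ordinal.{u}}
    (hγ : ∀ a < ω ^ γ, ∀ b < ω ^ γ, natSum a b < ω ^ γ) (p : Ordinal.{u}) (a : Ordinal.{u})
    (ha : a < ω ^ γ) (q : ℕ) (b : Ordinal.{u}) (hb : b < ω ^ γ) :
    natSum (ω ^ γ * p + a) (ω ^ γ * q + b) ≤ ω ^ γ * (p + q) + natSum a b := by
  have hw : ω ^ γ ≠ 0 := (opow_pos γ omega0_pos).ne'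
  induction p using WellFoundedLT.induction generalizing a q b with
  | ind p ihp =>
  induction q using Nat.strong_induction_on generalizing a b with
  | h q ihq =>
  induction a using WellFoundedLT.induction generalizing b with
  | ind a iha =>
  induction b using WellFoundedLT.induction with
  | ind b ihb =>
  refine natSum_le (fun c hc => ?_) (fun c hc => ?_)
  · obtain ⟨p', a', rfl, ha', h | ⟨rfl, h⟩⟩ := exists_eq_mul_add hw hc ha
    · refine (ihp p' h a' ha' q b hb).trans_lt ?_
      calc ω ^ γ * (p' + q) + natSum a' b < ω ^ γ * (p' + q) + ω ^ γ := by
            gcongr; exact hγ _ ha' _ hb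
        _ = ω ^ γ * (p' + 1 + q) := by
            rw [← mul_add_one, add_assoc, add_assoc, ← Nat.cast_one, ← Nat.cast_add,
              ← Nat.cast_add, add_comm q 1]
        _ ≤ ω ^ γ * (p + q) := by
            gcongr
            exact Order.add_one_le_of_lt h
        _ ≤ _ := le_self_add
    · refine (iha a' h ha' b hb).trans_lt ?_
      gcongr
      exact natSum_lt_left h
  · obtain ⟨q', b', rfl, hb', h | ⟨rfl, h⟩⟩ := exists_eq_mul_add hw hc hb
    · obtain ⟨n, rfl⟩ := lt_omega0.1 (h.trans (natCast_lt_omega0 q))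
      have hn : n < q := by exact_mod_cast h
      refine (ihq n hn a ha b' hb').trans_lt ?_
      calc ω ^ γ * (p + n) + natSum a b' < ω ^ γ * (p + n) + ω ^ γ := by
            gcongr; exact hγ _ ha _ hb'
        _ = ω ^ γ * (p + (n + 1 : ℕ)) := by
            rw [← mul_add_one, add_assoc]; simp
        _ ≤ ω ^ γ * (p + q) := by
            gcongr
            exact_mod_cast hn
        _ ≤ _ := le_self_add
    · refine (ihb b' h hb').trans_lt ?_
      gcongr
      exact natSum_lt_right h

/-- By induction on `γ`: both arguments are finitely many blocks `ω ^ c` plus a remainder for a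
common `c < γ`, so the block bound applies with `hγ` supplied by induction. -/
theorem natSum_lt_omega0_opow {γ a b : Ordinal.{u}} (ha : a < ω ^ γ) (hb : b < ω ^ γ) :
    natSum a b < ω ^ γ := by
  induction γ using WellFoundedLT.induction generalizing a b with
  | ind γ ih =>
  rcases eq_or_ne γ 0 with rfl | h0
  · rw [opow_zero, Order.lt_one_iff] at ha hb
    subst ha hb
    refine (natSum_le (c := 0) (fun a' h => ?_) (fun a' h => ?_)).trans_lt (by simp)
    · exact absurd h not_lt_zero
    · exact absurd h not_lt_zero
  · obtain ⟨c₁, hc₁, n₁, h₁⟩ := (lt_omega0_opow h0).1 ha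
    obtain ⟨c₂, hc₂, n₂, h₂⟩ := (lt_omega0_opow h0).1 hb
    set c := max c₁ c₂
    have hc : c < γ := max_lt hc₁ hc₂
    have hw : ω ^ c ≠ 0 := (opow_pos c omega0_pos).ne'
    have key : ∀ x c', c' ≤ c → ∀ n : ℕ, x < ω ^ c' * n → ∃ q : ℕ, ∃ r < ω ^ c, x = ω ^ c * q + r := by
      intro x c' hc' n hx
      have : x < ω ^ c * n := hx.trans_le (by gcongr; exact omega0_pos)
      obtain ⟨q, hq⟩ := lt_omega0.1 (((Ordinal.lt_mul_iff_div_lt hw).1 this).trans (natCast_lt_omega0 n))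
      exact ⟨q, x % ω ^ c, Ordinal.mod_lt _ hw, by rw [← hq, Ordinal.div_add_mod]⟩
    obtain ⟨p, a', ha', rfl⟩ := key a c₁ (le_max_left _ _) n₁ h₁
    obtain ⟨q, b', hb', rfl⟩ := key b c₂ (le_max_right _ _) n₂ h₂
    refine (natSum_mul_add_le (fun a ha b hb => ih c hc ha hb) p a' ha' q b' hb').trans_lt ?_
    calc ω ^ c * (p + q) + natSum a' b' < ω ^ c * (p + q) + ω ^ c := by
          gcongr; exact ih c hc ha' hb'
      _ = ω ^ c * ((p + q + 1 : ℕ) : Ordinal.{u}) := by push_cast; rw [mul_add_one]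
      _ < ω ^ c * ω := by gcongr; exact natCast_lt_omega0 _
      _ = ω ^ (c + 1) := by rw [opow_add, opow_one]
      _ ≤ ω ^ γ := opow_le_opow_right omega0_pos (Order.add_one_le_of_lt hc)

theorem natSum_lt_omega0_opow_mul {γ r a b : Ordinal.{u}} (ha : a < ω ^ γ * r) (hb : b < ω ^ γ) :
    natSum a b < ω ^ γ * r := by
  have hw : ω ^ γ ≠ 0 := (opow_pos γ omega0_pos).ne'
  have h1 := Ordinal.mod_lt a hw
  have h := natSum_mul_add_le (fun a ha b hb => natSum_lt_omega0_opow ha hb) (a / ω ^ γ)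
    (a % ω ^ γ) h1 0 b hb
  rw [Nat.cast_zero, mul_zero, zero_add, add_zero, Ordinal.div_add_mod] at h
  refine h.trans_lt ?_
  calc ω ^ γ * (a / ω ^ γ) + natSum (a % ω ^ γ) b < ω ^ γ * (a / ω ^ γ) + ω ^ γ := by
        gcongr; exact natSum_lt_omega0_opow h1 hb
    _ = ω ^ γ * (a / ω ^ γ + 1) := by rw [mul_add_one]
    _ ≤ ω ^ γ * r := by gcongr; exact Order.add_one_le_of_lt ((Ordinal.lt_mul_iff_div_lt hw).1 ha)

theorem accPt_principal_iff {x : Ordinal.{u}} {S : Set Ordinal.{u}} :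
    AccPt x (Filter.principal S) ↔ x ≠ 0 ∧ ∀ y < x, ∃ z ∈ S, y < z ∧ z < x := by
  rw [SuccOrder.accPt_principal, isMin_iff_eq_bot, Ordinal.bot_eq_zero]
  rfl

end Ordinal

/-! ### Cantor–Bendixson derivatives -/

/-- The transfinite Cantor–Bendixson derivative of `A`, taken in the class of all ordinals:
`x` has rank at least `ρ` relative to `A` if for each `σ < ρ` it is an accumulation point of the
elements of `A` of rank at least `σ`. The point `x` need not belong to `A`. -/
noncomputable def cbDeriv (A : Set Ordinal.{u}) (ρ : Ordinal.{u}) : Set Ordinal.{u} :=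
  {x | ∀ σ, ∀ _ : σ < ρ, AccPt x (Filter.principal (A ∩ cbDeriv A σ))}
termination_by ρ

section CBDeriv

variable {A B S T : Set Ordinal.{u}} {ρ σ x y : Ordinal.{u}}

theorem mem_cbDeriv : x ∈ cbDeriv A ρ ↔ ∀ σ < ρ, AccPt x (Filter.principal (A ∩ cbDeriv A σ)) := by
  rw [cbDeriv]; rfl

theorem cbDeriv_anti (h : σ ≤ ρ) : cbDeriv A ρ ⊆ cbDeriv A σ := fun _ hx =>
  mem_cbDeriv.2 fun τ hτ => mem_cbDeriv.1 hx τ (hτ.trans_le h)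

theorem cbDeriv_mono (h : A ⊆ B) : cbDeriv A ρ ⊆ cbDeriv B ρ := by
  induction ρ using WellFoundedLT.induction with
  | ind ρ ih =>
  intro x hx
  refine mem_cbDeriv.2 fun τ hτ => (mem_cbDeriv.1 hx τ hτ).mono ?_
  exact Filter.principal_mono.2 (inter_subset_inter h (ih τ hτ))

/-- If both alternatives fail, some interval below `x` contains no point of `S` of rank `a' < a` and
no point of `T` of rank `b' < b`. Yet it contains a point `z` of the union whose rank is at least
`natSum a' b` and `natSum a b'`. By induction `z`, or points just below it, violates one of the two
exclusions. -/
theorem mem_cbDeriv_natSum {a b : Ordinal.{u}} (hx : x ∈ cbDeriv (S ∪ T) (natSum a b)) :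
    x ∈ cbDeriv S a ∨ x ∈ cbDeriv T b := by
  obtain ⟨c, hc⟩ : ∃ c, c = natSum a b := ⟨_, rfl⟩
  rw [← hc] at hx
  induction c using WellFoundedLT.induction generalizing x a b with
  | ind c ih =>
  by_contra! hcon
  obtain ⟨h₁, h₂⟩ := hcon
  rw [mem_cbDeriv] at h₁ h₂
  push Not at h₁ h₂
  obtain ⟨a', ha', h₁⟩ := h₁
  obtain ⟨b', hb', h₂⟩ := h₂
  have hlt : max (natSum a' b) (natSum a b') < c := by
    rw [hc]; exact max_lt (natSum_lt_left ha') (natSum_lt_right hb')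
  have hacc := mem_cbDeriv.1 hx _ hlt
  have hx0 : x ≠ 0 := (accPt_principal_iff.1 hacc).1
  rw [accPt_principal_iff] at h₁ h₂
  push Not at h₁ h₂
  obtain ⟨y₁, hy₁, h₁⟩ := h₁ hx0
  obtain ⟨y₂, hy₂, h₂⟩ := h₂ hx0
  obtain ⟨z, ⟨hzST, hz⟩, hyz, hzx⟩ := (accPt_principal_iff.1 hacc).2 _ (max_lt hy₁ hy₂)
  rw [max_lt_iff] at hyz
  have e₁ : ∀ w ∈ S, w ∈ cbDeriv S a' → y₁ < w → ¬ w < x := fun w h1 h2 h3 h4 =>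
    (h₁ w ⟨h1, h2⟩ h3).not_gt h4
  have e₂ : ∀ w ∈ T, w ∈ cbDeriv T b' → y₂ < w → ¬ w < x := fun w h1 h2 h3 h4 =>
    (h₂ w ⟨h1, h2⟩ h3).not_gt h4
  rcases hzST with hzS | hzT
  · rcases ih _ ((le_max_left _ _).trans_lt hlt) (cbDeriv_anti (le_max_left _ _) hz) rfl
      with h | h
    · exact e₁ z hzS h hyz.1 hzx
    · obtain ⟨w, ⟨hw₁, hw₂⟩, hw₃, hw₄⟩ := (accPt_principal_iff.1 (mem_cbDeriv.1 h b' hb')).2 _ hyz.2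
      exact e₂ w hw₁ hw₂ hw₃ (hw₄.trans hzx)
  · rcases ih _ ((le_max_right _ _).trans_lt hlt) (cbDeriv_anti (le_max_right _ _) hz) rfl
      with h | h
    · obtain ⟨w, ⟨hw₁, hw₂⟩, hw₃, hw₄⟩ := (accPt_principal_iff.1 (mem_cbDeriv.1 h a' ha')).2 _ hyz.1
      exact e₁ w hw₁ hw₂ hw₃ (hw₄.trans hzx)
    · exact e₂ z hzT h hyz.2 hzx

/-- `S` has Cantor–Bendixson rank less than `γ`. -/
def CBRankLT (S : Set Ordinal.{u}) (γ : Ordinal.{u}) : Prop :=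
  ∃ ξ < γ, S ∩ cbDeriv S ξ = ∅

theorem cbRankLT_singleton {γ : Ordinal.{u}} (hγ : 1 < γ) : CBRankLT {x} γ := by
  refine ⟨1, hγ, eq_empty_of_forall_notMem ?_⟩
  rintro z ⟨rfl, hz⟩
  have hacc := mem_cbDeriv.1 hz 0 zero_lt_one
  obtain ⟨w, ⟨hw, -⟩, -, hwz⟩ := (accPt_principal_iff.1 hacc).2 _ (pos_iff_ne_zero.2 (accPt_principal_iff.1 hacc).1)
  exact hwz.ne hw

theorem cbDeriv_subset_diff {α r : Ordinal.{u}} (hα : α ≠ 0) (hS : CBRankLT S (ω ^ α)) :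
    cbDeriv A (ω ^ α * r) ⊆ cbDeriv (A \ S) (ω ^ α * r) := by
  obtain ⟨ξ, hξ, hS⟩ := hS
  have hlim : Order.IsSuccLimit (ω ^ α) := isSuccLimit_opow_left isSuccLimit_omega0 hα
  intro x hx
  refine mem_cbDeriv.2 fun σ hσ => ?_
  have hr : 0 < r := pos_iff_ne_zero.2 fun h => by simp [h] at hσ
  -- The successors leave room for one more approximation: `z` itself may lie in `S`, but rank `σ +
  -- 1` relative to `A \ S` puts points of `A \ S` of rank `σ` below it, while rank `ξ + 1` relative
  -- to `S` is impossible.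
  have hσ' : natSum (σ + 1) (ξ + 1) < ω ^ α * r :=
    natSum_lt_omega0_opow_mul ((isSuccLimit_mul_left hlim hr).add_one_lt hσ)
      (hlim.add_one_lt hξ)
  have hacc := mem_cbDeriv.1 hx _ hσ'
  refine accPt_principal_iff.2 ⟨(accPt_principal_iff.1 hacc).1, fun y hy => ?_⟩
  obtain ⟨z, ⟨hzA, hz⟩, hyz, hzx⟩ := (accPt_principal_iff.1 hacc).2 y hy
  have hz' : z ∈ cbDeriv ((A \ S) ∪ S) (natSum (σ + 1) (ξ + 1)) :=
    cbDeriv_mono (fun w hw => by by_cases h : w ∈ S <;> simp [h, hw]) hz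
  rcases mem_cbDeriv_natSum hz' with h | h
  · obtain ⟨w, hw, hw₁, hw₂⟩ := (accPt_principal_iff.1 (mem_cbDeriv.1 h σ (lt_add_one _))).2 y hyz
    exact ⟨w, hw, hw₁, hw₂.trans hzx⟩
  · have hacc' := mem_cbDeriv.1 h ξ (lt_add_one _)
    obtain ⟨w, hw, -⟩ := (accPt_principal_iff.1 hacc').2 y hyz
    exact absurd hw (by simp [hS])

theorem mem_cbDeriv_of_dvd {δ : Ordinal.{u}} (hx : x ≠ 0) (hxδ : x ≤ δ) (h : ω ^ ρ ∣ x) :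
    x ∈ cbDeriv (Iio δ) ρ := by
  induction ρ using WellFoundedLT.induction generalizing x with
  | ind ρ ih =>
  refine mem_cbDeriv.2 fun σ hσ => accPt_principal_iff.2 ⟨hx, fun y hy => ?_⟩
  have hw : ω ^ σ ≠ 0 := (opow_pos σ omega0_pos).ne'
  obtain ⟨u, rfl⟩ := h
  obtain ⟨τ, rfl⟩ := exists_add_of_le hσ.le
  have hτ : τ ≠ 0 := by rintro rfl; simp at hσ
  have hu : u ≠ 0 := by rintro rfl; simp at hx
  rw [opow_add, mul_assoc] at *
  have hlim : Order.IsSuccLimit (ω ^ τ * u) :=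
    isSuccLimit_mul_left (isSuccLimit_opow_left isSuccLimit_omega0 hτ) (pos_iff_ne_zero.2 hu)
  have hlt : y / ω ^ σ + 1 < ω ^ τ * u := hlim.add_one_lt ((Ordinal.lt_mul_iff_div_lt hw).1 hy)
  have h1 : ω ^ σ * (y / ω ^ σ + 1) < ω ^ σ * (ω ^ τ * u) := by gcongr
  -- The witness is the next multiple of `ω ^ σ` after `y`; it stays below `x` because the cofactor
  -- `ω ^ τ * u` is a limit.
  refine ⟨ω ^ σ * (y / ω ^ σ + 1), ⟨h1.trans_le hxδ, ih σ hσ ?_ (h1.le.trans hxδ)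
    (dvd_mul_right _ _)⟩, Ordinal.lt_mul_div_add y hw |>.trans_eq (mul_add_one _ _).symm, h1⟩
  exact mul_ne_zero hw (by simp)

end CBDeriv


/-! ### Building closed copies from ranks -/

section ClosedCopy

variable {A : Set Ordinal.{u}} {f g : Ordinal.{u} → Ordinal.{u}} {a b x y z γ ρ : Ordinal.{u}}

/-- `f` maps `(0, γ]` onto a closed copy with maximum `x`, lying above `y`, and contained in `A`
except perhaps for its maximum. -/
structure IsClosedCopy (f : Ordinal.{u} → Ordinal.{u}) (A : Set Ordinal.{u})
    (y x γ : Ordinal.{u}) : Prop where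
  strictMonoOn : StrictMonoOn f (Ioc 0 γ)
  exists_lt : ∀ l ∈ Ioc 0 γ, Order.IsSuccLimit l → ∀ z < f l, ∃ ξ ∈ Ioo 0 l, z < f ξ
  apply_last : f γ = x
  mem : ∀ ξ ∈ Ioo 0 γ, f ξ ∈ A
  lt : ∀ ξ ∈ Ioc 0 γ, y < f ξ
  le : y ≤ x

namespace IsClosedCopy

theorem apply_le (hf : IsClosedCopy f A y x γ) {ξ : Ordinal.{u}} (hξ : ξ ∈ Ioc 0 γ) : f ξ ≤ x := by
  rw [← hf.apply_last]
  exact hf.strictMonoOn.monotoneOn hξ ⟨hξ.1.trans_le hξ.2, le_rfl⟩ hξ.2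

theorem congr (hf : IsClosedCopy f A y x γ) (h : ∀ ξ ≤ γ, g ξ = f ξ) : IsClosedCopy g A y x γ where
  strictMonoOn ξ hξ ζ hζ h' := by rw [h _ hξ.2, h _ hζ.2]; exact hf.strictMonoOn hξ hζ h'
  exists_lt l hl hlim z hz := by
    rw [h _ hl.2] at hz
    obtain ⟨ξ, hξ, h'⟩ := hf.exists_lt l hl hlim z hz
    exact ⟨ξ, hξ, by rwa [h _ (hξ.2.le.trans hl.2)]⟩
  apply_last := by rw [h _ le_rfl, hf.apply_last]
  mem ξ hξ := by rw [h _ hξ.2.le]; exact hf.mem ξ hξ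
  lt ξ hξ := by rw [h _ hξ.2]; exact hf.lt ξ hξ
  le := hf.le

open Classical in
-- Half-open index intervals make concatenation ordinal addition: `(0, a + b]` is `(0, a]` followed
-- by a shift of `(0, b]`. The old maximum becomes an interior value, so it must now lie in `A`.
theorem append (hf : IsClosedCopy f A y x a) (hg : IsClosedCopy g A x z b) (hx : 0 < a → x ∈ A)
    (hb : 0 < b) :
    IsClosedCopy (fun ξ => if ξ ≤ a then f ξ else g (ξ - a)) A y z (a + b) := by
  have hsub : ∀ ξ, a < ξ → ∃ ζ, 0 < ζ ∧ ξ = a + ζ := fun ξ h =>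
    ⟨ξ - a, Ordinal.lt_sub.2 (by simpa using h), (Ordinal.add_sub_cancel_of_le h.le).symm⟩
  have hval : ∀ ζ, 0 < ζ → (if a + ζ ≤ a then f (a + ζ) else g (a + ζ - a)) = g ζ := by
    intro ζ hζ
    have : ¬ a + ζ ≤ a := by simpa using hζ.ne'
    rw [if_neg this, Ordinal.add_sub_cancel]
  refine ⟨?_, ?_, ?_, ?_, ?_, hf.le.trans hg.le⟩
  · intro ξ hξ ζ hζ hlt
    dsimp only
    rcases le_or_gt ζ a with h | h
    · rw [if_pos h, if_pos (hlt.le.trans h)]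
      exact hf.strictMonoOn ⟨hξ.1, hlt.le.trans h⟩ ⟨hζ.1, h⟩ hlt
    · obtain ⟨ζ, hζ0, rfl⟩ := hsub ζ h
      have hζb : ζ ∈ Ioc 0 b := ⟨hζ0, by simpa using hζ.2⟩
      rw [hval ζ hζ0]
      rcases le_or_gt ξ a with h' | h'
      · rw [if_pos h']
        exact (hf.apply_le ⟨hξ.1, h'⟩).trans_lt (hg.lt ζ hζb)
      · obtain ⟨ξ, hξ0, rfl⟩ := hsub ξ h'
        rw [hval ξ hξ0]
        exact hg.strictMonoOn ⟨hξ0, by simpa using hξ.2⟩ hζb (by simpa using hlt)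
  · intro l hl hlim w hw
    rcases le_or_gt l a with h | h
    · rw [if_pos h] at hw
      obtain ⟨ξ, hξ, h'⟩ := hf.exists_lt l ⟨hl.1, h⟩ hlim w hw
      exact ⟨ξ, hξ, by rwa [if_pos (hξ.2.le.trans h)]⟩
    · obtain ⟨l, hl0, rfl⟩ := hsub l h
      rw [hval l hl0] at hw
      have hlim' : Order.IsSuccLimit l := by
        rcases isSuccLimit_add_iff.1 hlim with h' | h'
        · exact h'
        · exact absurd h'.1 hl0.ne'
      obtain ⟨ξ, hξ, h'⟩ := hg.exists_lt l ⟨hl0, by simpa using hl.2⟩ hlim' w hw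
      exact ⟨a + ξ, ⟨hξ.1.trans_le le_add_self, by simpa using hξ.2⟩, by rwa [hval ξ hξ.1]⟩
  · rw [hval b hb, hg.apply_last]
  · intro ξ hξ
    rcases le_or_gt ξ a with h | h
    · rw [if_pos h]
      rcases h.eq_or_lt with rfl | h
      · rw [hf.apply_last]; exact hx hξ.1
      · exact hf.mem ξ ⟨hξ.1, h⟩
    · obtain ⟨ξ, hξ0, rfl⟩ := hsub ξ h
      rw [hval ξ hξ0]
      exact hg.mem ξ ⟨hξ0, by simpa using hξ.2⟩
  · intro ξ hξ
    rcases le_or_gt ξ a with h | h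
    · rw [if_pos h]
      exact hf.lt ξ ⟨hξ.1, h⟩
    · obtain ⟨ξ, hξ0, rfl⟩ := hsub ξ h
      rw [hval ξ hξ0]
      exact hf.le.trans_lt (hg.lt ξ ⟨hξ0, by simpa using hξ.2⟩)

open Classical in
theorem exists_of_chain {f : ℕ → Ordinal.{u} → Ordinal.{u}} {s θ : ℕ → Ordinal.{u}}
    (hf : ∀ n, IsClosedCopy (f n) A y (s n) (θ n)) (hθ : Monotone θ)
    (hext : ∀ n, ∀ ξ ≤ θ n, f (n + 1) ξ = f n ξ) (hγ : ∀ ζ < γ, ∃ n, ζ ≤ θ n)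
    (hθγ : ∀ n, θ n < γ) (hsA : ∀ n, 0 < θ n → s n ∈ A) (hsx : ∀ n, s n < x)
    (hx : ∀ z < x, ∃ n, 0 < θ n ∧ z < s n) :
    ∃ F, IsClosedCopy F A y x γ := by
  let F : Ordinal.{u} → Ordinal.{u} := fun ξ =>
    if h : ∃ n, ξ ≤ θ n then f (Nat.find h) ξ else x
  have hext' : ∀ n m, n ≤ m → ∀ ξ ≤ θ n, f m ξ = f n ξ := by
    intro n m hnm
    induction m, hnm using Nat.le_induction with
    | base => exact fun _ _ => rfl
    | succ m hnm ih =>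
      intro ξ hξ
      rw [hext m ξ (hξ.trans (hθ hnm)), ih ξ hξ]
  have hF : ∀ n ξ, ξ ≤ θ n → F ξ = f n ξ := by
    intro n ξ h
    have h' : ∃ n, ξ ≤ θ n := ⟨n, h⟩
    simp only [F, dif_pos h']
    exact (hext' _ _ (Nat.find_min' h' h) ξ (Nat.find_spec h')).symm
  have hFn : ∀ n, IsClosedCopy F A y (s n) (θ n) := fun n => (hf n).congr (hF n)
  have hFγ : F γ = x := by
    have h' : ¬ ∃ n, γ ≤ θ n := by
      rintro ⟨n, h⟩; exact (hθγ n).not_ge h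
    simp only [F, dif_neg h']
  refine ⟨F, ?_, ?_, hFγ, ?_, ?_, (hf 0).le.trans (hsx 0).le⟩
  · intro ξ hξ ζ hζ hlt
    rcases hζ.2.eq_or_lt with rfl | h
    · obtain ⟨n, hn⟩ := hγ ξ hlt
      rw [hFγ]
      exact ((hFn n).apply_le ⟨hξ.1, hn⟩).trans_lt (hsx n)
    · obtain ⟨n, hn⟩ := hγ ζ h
      exact (hFn n).strictMonoOn ⟨hξ.1, hlt.le.trans hn⟩ ⟨hζ.1, hn⟩ hlt
  · intro l hl hlim z hz
    rcases hl.2.eq_or_lt with rfl | h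
    · rw [hFγ] at hz
      obtain ⟨n, hn, hn'⟩ := hx z hz
      exact ⟨θ n, ⟨hn, hθγ n⟩, by rwa [(hFn n).apply_last]⟩
    · obtain ⟨n, hn⟩ := hγ l h
      exact (hFn n).exists_lt l ⟨hl.1, hn⟩ hlim z hz
  · intro ξ hξ
    obtain ⟨n, hn⟩ := hγ ξ hξ.2
    rcases hn.eq_or_lt with rfl | h
    · rw [(hFn n).apply_last]; exact hsA n hξ.1
    · exact (hFn n).mem ξ ⟨hξ.1, h⟩
  · intro ξ hξ
    rcases hξ.2.eq_or_lt with rfl | h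
    · rw [hFγ]; exact (hf 0).le.trans_lt (hsx 0)
    · obtain ⟨n, hn⟩ := hγ ξ h
      exact (hFn n).lt ξ ⟨hξ.1, hn⟩

open Filter Topology in
theorem continuous (hf : IsClosedCopy f A y x γ) {γ' δ : Ordinal.{u}} (hγ : ∀ ζ < γ', 1 + ζ ≤ γ)
    (hδ : ∀ ζ < γ', f (1 + ζ) < δ) :
    Continuous (fun ζ : Iio γ' => (⟨f (1 + ζ), hδ ζ ζ.2⟩ : Iio δ)) := by
  have h1 : ∀ ζ < γ', 1 + ζ ∈ Ioc 0 γ := fun ζ hζ =>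
    ⟨zero_lt_one.trans_le le_self_add, hγ ζ hζ⟩
  refine Continuous.subtype_mk (f := fun ζ : Iio γ' => f (1 + ζ)) ?_ _
  have hc : ContinuousOn (fun ζ => f (1 + ζ)) (Iio γ') := by
    intro l hl
    refine ContinuousAt.continuousWithinAt ?_
    by_cases hlim : Order.IsSuccLimit l
    -- Neighbourhoods of an ordinal are determined from the left, so only left continuity at limits
    -- matters.
    · rw [ContinuousAt, ← SuccOrder.nhdsLE_eq_nhds l]
      refine tendsto_order.2 ⟨fun z hz => ?_, fun z hz => ?_⟩
      · have hlim' : Order.IsSuccLimit (1 + l) := isSuccLimit_add _ hlim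
        obtain ⟨ξ, hξ, hzξ⟩ := hf.exists_lt _ (h1 l hl) hlim' z hz
        obtain ⟨ζ, rfl⟩ := exists_add_of_le (Order.one_le_iff_pos.2 hξ.1)
        have hζl : ζ < l := by simpa using hξ.2
        filter_upwards [Ioc_mem_nhdsLE hζl] with η hη
        refine hzξ.trans (hf.strictMonoOn (h1 ζ (hζl.trans hl)) (h1 η (hη.2.trans_lt hl)) ?_)
        simpa using hη.1
      · filter_upwards [self_mem_nhdsWithin] with η hη
        refine lt_of_le_of_lt ?_ hz
        exact hf.strictMonoOn.monotoneOn (h1 η (lt_of_le_of_lt hη hl)) (h1 l hl)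
          (by simpa using hη)
    · rw [ContinuousAt, SuccOrder.nhds_eq_pure.2 hlim]
      exact tendsto_pure_nhds _ _
  exact hc.domRestrict

theorem strictMono (hf : IsClosedCopy f A y x γ) {γ' δ : Ordinal.{u}} (hγ : ∀ ζ < γ', 1 + ζ ≤ γ)
    (hδ : ∀ ζ < γ', f (1 + ζ) < δ) :
    StrictMono (fun ζ : Iio γ' => (⟨f (1 + ζ), hδ ζ ζ.2⟩ : Iio δ)) := by
  intro ζ ξ h
  refine hf.strictMonoOn ⟨zero_lt_one.trans_le le_self_add, hγ ζ ζ.2⟩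
    ⟨zero_lt_one.trans_le le_self_add, hγ ξ ξ.2⟩ ?_
  simpa using h

end IsClosedCopy

theorem exists_seq_forall_rel {X : Type*} {P : ℕ → X → X → Prop} (h : ∀ n z, ∃ z', P n z z')
    (z₀ : X) : ∃ s : ℕ → X, s 0 = z₀ ∧ ∀ n, P n (s n) (s (n + 1)) := by
  choose F hF using h
  exact ⟨fun n => Nat.rec z₀ F n, rfl, fun n => hF n _⟩

open Classical in
-- Choose a sequence cofinal in `x` whose terms have ranks `r n < ρ`, each value recurring
-- infinitely often, and place a closed copy of `ω ^ r n` between consecutive terms. The lengths add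
-- up to `ω ^ ρ`.
theorem exists_isClosedCopy (hρ : (Iio ρ).Countable) (hxc : (Iio x).Countable)
    (hx : x ∈ cbDeriv A ρ) (hyx : y < x) : ∃ f, IsClosedCopy f A y x (ω ^ ρ) := by
  induction ρ using WellFoundedLT.induction generalizing x y with
  | ind ρ ih =>
  rcases eq_or_ne ρ 0 with rfl | h0
  · have h1 : ∀ ξ ∈ Ioc (0 : Ordinal.{u}) (ω ^ (0 : Ordinal.{u})), ξ = 1 := fun ξ hξ =>
      le_antisymm (by simpa using hξ.2) (Order.one_le_iff_pos.2 hξ.1)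
    refine ⟨fun _ => x, ⟨fun ξ hξ ζ hζ h => ?_, fun l hl hlim => ?_, rfl, fun ξ hξ => ?_,
      fun _ _ => hyx, hyx.le⟩⟩
    · rw [h1 ξ hξ, h1 ζ hζ] at h
      exact absurd h (lt_irrefl _)
    · rw [h1 l hl, ← zero_add (1 : Ordinal.{u}), ← Order.succ_eq_add_one] at hlim
      exact absurd hlim (Order.not_isSuccLimit_succ _)
    · have := h1 ξ ⟨hξ.1, hξ.2.le⟩
      subst this
      simp at hξ
  · have : Nonempty (Iio ρ) := ⟨⟨0, pos_iff_ne_zero.2 h0⟩⟩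
    have : Nonempty (Iio x) := ⟨⟨y, hyx⟩⟩
    have := hρ.to_subtype
    have := hxc.to_subtype
    obtain ⟨r', hr'⟩ := exists_surjective_nat (Iio ρ)
    obtain ⟨e, he⟩ := exists_surjective_nat (Iio x)
    let r : ℕ → Ordinal.{u} := fun n => r' n.unpair.1
    have hr : ∀ n, r n < ρ := fun n => (r' _).2
    have hr_inf : ∀ σ < ρ, ∀ n, ∃ n' ≥ n, r n' = σ := by
      intro σ hσ n
      obtain ⟨i, hi⟩ := hr' ⟨σ, hσ⟩
      refine ⟨Nat.pair i n, Nat.right_le_pair i n, ?_⟩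
      simp [r, hi]
    obtain ⟨s, hs0, hs⟩ := exists_seq_forall_rel (X := Iio x)
      -- Passing the `n`-th element of an enumeration of `Iio x` makes the sequence cofinal.
      (P := fun n z z' => z < z' ∧ e n < z' ∧ (z' : Ordinal.{u}) ∈ A ∩ cbDeriv A (r n))
      (fun n z => by
        obtain ⟨z', hz', hlt, hz'x⟩ :=
          (accPt_principal_iff.1 (mem_cbDeriv.1 hx (r n) (hr n))).2 _ (max_lt z.2 (e n).2)
        exact ⟨⟨z', hz'x⟩, (le_max_left _ _).trans_lt hlt, (le_max_right _ _).trans_lt hlt, hz'⟩)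
      ⟨y, hyx⟩
    have hpiece : ∀ n, ∃ g, IsClosedCopy g A (s n) (s (n + 1)) (ω ^ r n) := fun n =>
      ih (r n) (hr n) (hρ.mono (Iio_subset_Iio (hr n).le))
        (hxc.mono (Iio_subset_Iio (s (n + 1)).2.le)) (hs n).2.2.2 (hs n).1
    choose g hg using hpiece
    obtain ⟨θ, hθ0, hθs⟩ : ∃ θ : ℕ → Ordinal.{u}, θ 0 = 0 ∧ ∀ n, θ (n + 1) = θ n + ω ^ r n :=
      ⟨Nat.rec 0 (fun n t => t + ω ^ r n), rfl, fun _ => rfl⟩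
    have hθlt : ∀ n, θ n < ω ^ ρ := by
      intro n
      induction n with
      | zero => rw [hθ0]; exact opow_pos ρ omega0_pos
      | succ n ihn =>
        rw [hθs]
        exact isPrincipal_add_omega0_opow ρ ihn
          ((opow_lt_opow_iff_right one_lt_omega0).2 (hr n))
    have hθmono : StrictMono θ := strictMono_nat_of_lt_succ fun n => by
      rw [hθs]; exact lt_add_of_pos_right _ (opow_pos _ omega0_pos)
    obtain ⟨f, hf0, hfs⟩ : ∃ f : ℕ → Ordinal.{u} → Ordinal.{u}, (f 0 = fun _ => y) ∧
        ∀ n, f (n + 1) = fun ξ => if ξ ≤ θ n then f n ξ else g n (ξ - θ n) :=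
      ⟨Nat.rec (fun _ => y) (fun n f' ξ => if ξ ≤ θ n then f' ξ else g n (ξ - θ n)),
        rfl, fun _ => rfl⟩
    have hsA : ∀ n, 0 < θ n → (s n : Ordinal.{u}) ∈ A := by
      rintro (_ | n) h
      · exact absurd hθ0 h.ne'
      · exact (hs n).2.2.1
    refine IsClosedCopy.exists_of_chain (f := f) (s := fun n => s n) (θ := θ) (fun n => ?_)
      hθmono.monotone (fun n ξ h => ?_) (fun ζ hζ => ?_) hθlt hsA (fun n => (s n).2)
      (fun z hz => ?_)
    · induction n with
      | zero =>
        have hemp : ∀ ξ, ξ ∉ Ioc (0 : Ordinal.{u}) (θ 0) := fun ξ hξ => (hξ.1.trans_le hξ.2).ne' hθ0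
        exact ⟨fun ξ hξ => absurd hξ (hemp ξ), fun l hl => absurd hl (hemp l),
          by rw [hf0, hs0], fun ξ hξ => absurd ⟨hξ.1, hξ.2.le⟩ (hemp ξ),
          fun l hl => absurd hl (hemp l), by rw [hs0]⟩
      | succ n ihn =>
        rw [hfs, hθs]
        exact ihn.append (hg n) (hsA n) (opow_pos _ omega0_pos)
    · rw [hfs]; exact if_pos h
    -- It suffices to pass `ω ^ σ * j`, and this happens after `σ` has been visited `j` times.
    · obtain ⟨σ, hσ, j, hj⟩ := (lt_omega0_opow h0).1 hζ
      suffices h : ∀ j : ℕ, ∃ n, ω ^ σ * j ≤ θ n by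
        obtain ⟨n, hn⟩ := h j
        exact ⟨n, hj.le.trans hn⟩
      intro j
      induction j with
      | zero => exact ⟨0, by simp⟩
      | succ j ihj =>
        obtain ⟨n, hn⟩ := ihj
        obtain ⟨n', hn', hrn⟩ := hr_inf σ hσ n
        refine ⟨n' + 1, ?_⟩
        rw [hθs, hrn, Nat.cast_add_one, mul_add_one]
        gcongr
        exact hn.trans (hθmono.monotone hn')
    · obtain ⟨n, hn⟩ := he ⟨z, hz⟩
      refine ⟨n + 1, by rw [← hθ0]; exact hθmono (Nat.succ_pos n), ?_⟩
      have := (hs n).2.1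
      rw [hn] at this
      exact this

/-- The least points `t ξ` of `A` of rank `ξ` increase strictly, and their supremum has rank `ω ^
α`. It may lie outside `A`, which is why a closed copy is not required to have its maximum in `A`.
-/
theorem exists_isClosedCopy_of_not_cbRankLT {α δ : Ordinal.{u}} (hα : α ≠ 0)
    (hαc : (Iio (ω ^ α)).Countable) (hδ : (Iio δ).Countable) (hAδ : A ⊆ Iio δ)
    (hA : ¬ CBRankLT A (ω ^ α)) : ∃ f y x, IsClosedCopy f A y x (ω ^ ω ^ α) := by
  have hne : ∀ ξ < ω ^ α, (A ∩ cbDeriv A ξ).Nonempty := fun ξ hξ => by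
    by_contra h
    exact hA ⟨ξ, hξ, not_nonempty_iff_eq_empty.1 h⟩
  have hlim : Order.IsSuccLimit (ω ^ α) := isSuccLimit_opow_left isSuccLimit_omega0 hα
  let t : Ordinal.{u} → Ordinal.{u} := fun ξ => sInf (A ∩ cbDeriv A ξ)
  have ht : ∀ ξ < ω ^ α, t ξ ∈ A ∩ cbDeriv A ξ := fun ξ hξ => csInf_mem (hne ξ hξ)
  have htlt : ∀ σ ξ, σ < ξ → ξ < ω ^ α → t σ < t ξ := by
    intro σ ξ h hξ
    have hacc := accPt_principal_iff.1 (mem_cbDeriv.1 (ht ξ hξ).2 σ h)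
    obtain ⟨z, hz, -, hzlt⟩ := hacc.2 0 (pos_iff_ne_zero.2 hacc.1)
    exact (csInf_le' hz).trans_lt hzlt
  have hbdd : BddAbove (t '' Iio (ω ^ α)) :=
    ⟨δ, by rintro _ ⟨ξ, hξ, rfl⟩; exact (hAδ (ht ξ hξ).1).le⟩
  have hlub := isLUB_csSup (s := t '' Iio (ω ^ α)) ⟨t 0, mem_image_of_mem _ (opow_pos α omega0_pos)⟩ hbdd
  set x := sSup (t '' Iio (ω ^ α))
  have hxδ : x ≤ δ := hlub.2 (by rintro _ ⟨ξ, hξ, rfl⟩; exact (hAδ (ht ξ hξ).1).le)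
  have htx : ∀ ξ < ω ^ α, t ξ < x := fun ξ hξ =>
    (htlt ξ (ξ + 1) (lt_add_one ξ) (hlim.add_one_lt hξ)).trans_le
      (hlub.1 (mem_image_of_mem _ (hlim.add_one_lt hξ)))
  have hx : x ∈ cbDeriv A (ω ^ α) := by
    refine mem_cbDeriv.2 fun σ hσ => accPt_principal_iff.2
      ⟨(zero_le.trans_lt (htx σ hσ)).ne', fun y hy => ?_⟩
    obtain ⟨_, ⟨ξ, hξ, rfl⟩, hyξ⟩ := (lt_isLUB_iff hlub).1 hy
    have hm : max σ ξ < ω ^ α := max_lt hσ hξ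
    refine ⟨t (max σ ξ), ⟨(ht _ hm).1, cbDeriv_anti (le_max_left _ _) (ht _ hm).2⟩,
      hyξ.trans_le ?_, htx _ hm⟩
    exact csInf_le_csInf (OrderBot.bddBelow _) (hne _ hm)
      (inter_subset_inter_right _ (cbDeriv_anti (le_max_right _ _)))
  obtain ⟨f, hf⟩ := exists_isClosedCopy hαc (hδ.mono (Iio_subset_Iio hxδ)) hx
    (zero_le.trans_lt (htx 0 (opow_pos α omega0_pos)))
  exact ⟨f, 0, x, hf⟩

end ClosedCopy


/-! ### Thinning to a set that avoids a relation -/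

theorem cbDeriv_subset_diff_biUnion {ι : Type*} (I : Finset ι) (S : ι → Set Ordinal.{u})
    {A : Set Ordinal.{u}} {α r : Ordinal.{u}} (hα : α ≠ 0)
    (hS : ∀ i ∈ I, CBRankLT (S i) (ω ^ α)) :
    cbDeriv A (ω ^ α * r) ⊆ cbDeriv (A \ ⋃ i ∈ I, S i) (ω ^ α * r) := by
  classical
  induction I using Finset.induction_on with
  | empty => simp
  | insert i I hi ih =>
    refine (ih fun j hj => hS j (Finset.mem_insert_of_mem hj)).trans ?_
    refine (cbDeriv_subset_diff hα (hS i (Finset.mem_insert_self i I))).trans ?_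
    rw [Finset.set_biUnion_insert, sdiff_sdiff, union_comm]

/-- A finite set avoiding the relation `R` extends to one in which ranks relative to `Iio δ` of the
form `ω ^ α * r` become ranks `r`, provided that the `R`-neighbourhoods have rank less than
`ω ^ α`. -/
theorem exists_superset_cbDeriv {δ α β : Ordinal.{u}} {R : Ordinal.{u} → Ordinal.{u} → Prop}
    (hδ : (Iio δ).Countable) (hβ : (Iio β).Countable) (hα : α ≠ 0) (hR : ∀ x y, R x y → R y x)
    (hsmall : ∀ z < δ, CBRankLT {x | x < δ ∧ R z x} (ω ^ α)) (G : Finset Ordinal.{u})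
    (hGδ : ↑G ⊆ Iio δ) (hG : (G : Set Ordinal.{u}).Pairwise fun x y => ¬ R x y) :
    ∃ Y : Set Ordinal.{u}, ↑G ⊆ Y ∧ Y ⊆ Iio δ ∧ Y.Pairwise (fun x y => ¬ R x y) ∧
      ∀ r ≤ β, ∀ y ∈ Y, y ∈ cbDeriv (Iio δ) (ω ^ α * r) → y ∈ cbDeriv Y r := by
  classical
  let P := {F : Finset Ordinal.{u} // ↑F ⊆ Iio δ ∧
    (F : Set Ordinal.{u}).Pairwise fun x y => ¬ R x y}
  have h1α : 1 < ω ^ α := one_lt_opow.2 ⟨one_lt_omega0, hα⟩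
  -- Density: deleting the `R`-neighbourhoods of the finitely many points of `F` keeps the rank of
  -- `y`, so a compatible `z` of the required rank exists arbitrarily close below `y`.
  have ext : ∀ F : P, ∀ y ∈ F.1, ∀ σ, y ∈ cbDeriv (Iio δ) (ω ^ α * (σ + 1)) → ∀ b < y,
      ∃ F' ≥ F, ∃ z ∈ F'.1, b < z ∧ z < y ∧ z ∈ cbDeriv (Iio δ) (ω ^ α * σ) := by
    intro F y hyF σ hy b hb
    have h1 := cbDeriv_subset_diff_biUnion F.1 (fun g => {x | x < δ ∧ R g x}) hα
      (fun g hg => hsmall g (F.2.1 hg)) hy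
    have h2 := cbDeriv_subset_diff_biUnion F.1 (fun g => {g}) hα
      (fun g hg => cbRankLT_singleton h1α) h1
    have hlt : ω ^ α * σ < ω ^ α * (σ + 1) := by
      rw [mul_add_one]; exact lt_add_of_pos_right _ (opow_pos _ omega0_pos)
    obtain ⟨z, ⟨⟨⟨hzδ, hzR⟩, hzF⟩, hz⟩, hbz, hzy⟩ :=
      (accPt_principal_iff.1 (mem_cbDeriv.1 h2 _ hlt)).2 b hb
    have hzδ' : z < δ := hzδ
    simp only [mem_iUnion, not_exists, mem_ofPred_eq, not_and] at hzR
    refine ⟨⟨insert z F.1, ?_, ?_⟩, Finset.subset_insert z F.1, z, Finset.mem_insert_self _ _,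
      hbz, hzy, cbDeriv_mono (sdiff_subset.trans sdiff_subset) hz⟩
    · rw [Finset.coe_insert]
      exact insert_subset hzδ F.2.1
    · rw [Finset.coe_insert]
      refine F.2.2.insert fun g hg _ => ⟨fun h => hzR g hg hzδ' (hR _ _ h), hzR g hg hzδ'⟩
  have := hδ.to_subtype
  have := hβ.to_subtype
  let _ : Encodable (Iio δ × Iio β × Iio δ) := Encodable.ofCountable _
  -- There are countably many requirements `(y, σ, b)`. The second alternative, that no extension of
  -- `F` makes the requirement relevant, ensures cofinality; it is refuted later for `y ∈ Y` by
  -- directedness of the ideal.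
  let D : Iio δ × Iio β × Iio δ → Order.Cofinal P := fun t =>
    { carrier := {F | (∃ z ∈ F.1, (t.2.2 : Ordinal.{u}) < z ∧ z < t.1 ∧
          z ∈ cbDeriv (Iio δ) (ω ^ α * t.2.1)) ∨
        ¬ ((t.1 : Ordinal.{u}) ∈ cbDeriv (Iio δ) (ω ^ α * (t.2.1 + 1)) ∧ t.2.2 < t.1 ∧
          ∃ F' ≥ F, (t.1 : Ordinal.{u}) ∈ F'.1)}
      isCofinal := by
        intro F
        by_cases h : (t.1 : Ordinal.{u}) ∈ cbDeriv (Iio δ) (ω ^ α * (t.2.1 + 1)) ∧ t.2.2 < t.1 ∧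
          ∃ F' ≥ F, (t.1 : Ordinal.{u}) ∈ F'.1
        · obtain ⟨hy, hb, F', hF', hyF'⟩ := h
          obtain ⟨F'', hF'', hz⟩ := ext F' _ hyF' _ hy _ hb
          exact ⟨F'', Or.inl hz, hF'.trans hF''⟩
        · exact ⟨F, Or.inr h, le_rfl⟩ }
  let I := Order.idealOfCofinals (⟨G, hGδ, hG⟩ : P) D
  refine ⟨⋃ F ∈ I, ↑F.1, fun g hg => ?_, ?_, ?_, ?_⟩
  · exact mem_biUnion (Order.mem_idealOfCofinals _ _) hg
  · exact iUnion₂_subset fun F _ => F.2.1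
  · intro x hx y hy hxy
    rw [mem_iUnion₂] at hx hy
    obtain ⟨F, hF, hx⟩ := hx
    obtain ⟨F', hF', hy⟩ := hy
    obtain ⟨K, -, hK₁, hK₂⟩ := I.directed F hF F' hF'
    exact K.2.2 (hK₁ hx) (hK₂ hy) hxy
  · intro r
    induction r using WellFoundedLT.induction with
    | ind r ih =>
    intro hr y hyY hy
    refine mem_cbDeriv.2 fun σ hσ => accPt_principal_iff.2 ⟨?_, fun b hb => ?_⟩
    · have h0 : 0 < ω ^ α * r := mul_pos (opow_pos α omega0_pos) (zero_le.trans_lt hσ)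
      exact (accPt_principal_iff.1 (mem_cbDeriv.1 hy 0 h0)).1
    · rw [mem_iUnion₂] at hyY
      obtain ⟨F, hF, hyF⟩ := hyY
      have hyδ : y < δ := F.2.1 hyF
      obtain ⟨K, hK, hKI⟩ := Order.cofinal_meets_idealOfCofinals (⟨G, hGδ, hG⟩ : P) D
        ⟨⟨y, hyδ⟩, ⟨σ, hσ.trans_le hr⟩, ⟨b, hb.trans hyδ⟩⟩
      obtain ⟨L, hL, hL₁, hL₂⟩ := I.directed F hF K hKI
      have hy' : y ∈ cbDeriv (Iio δ) (ω ^ α * (σ + 1)) :=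
        cbDeriv_anti (by gcongr; exact Order.add_one_le_of_lt hσ) hy
      rcases hK with ⟨z, hzK, hbz, hzy, hz⟩ | hK
      · have hzY : z ∈ ⋃ F ∈ I, (F.1 : Set Ordinal.{u}) := mem_biUnion hKI hzK
        exact ⟨z, ⟨hzY, ih σ hσ (hσ.le.trans hr) z hzY hz⟩, hbz, hzy⟩
      · exact absurd ⟨hy', hb, L, hL₂, hL₁ hyF⟩ hK

/-- In increasing order, each point of `G` is the maximum of a copy of `ω ^ β` placed above the
preceding point. -/
theorem exists_isClosedCopy_of_finset {Y : Set Ordinal.{u}} {β : Ordinal.{u}} (hβ : β ≠ 0)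
    (hβc : (Iio β).Countable) (hYc : ∀ y ∈ Y, (Iio y).Countable) (G : Finset Ordinal.{u})
    (hG : ∀ g ∈ G, g ∈ Y ∩ cbDeriv Y β) :
    ∃ f x, IsClosedCopy f Y 0 x (ω ^ β * (G.card : Ordinal.{u})) ∧ (G = ∅ ∧ x = 0 ∨ x ∈ G) := by
  classical
  induction G using Finset.induction_on_max with
  | empty =>
    refine ⟨fun _ => 0, 0, ⟨?_, ?_, rfl, ?_, ?_, le_rfl⟩, Or.inl ⟨rfl, rfl⟩⟩ <;>
      simp [StrictMonoOn]
  | insert a G ha ih =>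
    obtain ⟨f, x, hf, hx⟩ := ih fun g hg => hG g (Finset.mem_insert_of_mem hg)
    have haG := hG a (Finset.mem_insert_self a G)
    have hxa : x < a := by
      rcases hx with ⟨-, rfl⟩ | hx
      · exact pos_iff_ne_zero.2
          (accPt_principal_iff.1 (mem_cbDeriv.1 haG.2 0 (pos_iff_ne_zero.2 hβ))).1
      · exact ha x hx
    obtain ⟨g, hg⟩ := exists_isClosedCopy hβc (hYc a haG.1) haG.2 hxa
    have hcard : ω ^ β * ((insert a G).card : Ordinal.{u}) = ω ^ β * (G.card : Ordinal.{u}) + ω ^ β := by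
      rw [Finset.card_insert_of_notMem fun h => (ha a h).false, Nat.cast_add_one, mul_add_one]
    rw [hcard]
    refine ⟨_, a, hf.append hg (fun h => ?_) (opow_pos β omega0_pos),
      Or.inr (Finset.mem_insert_self a G)⟩
    rcases hx with ⟨rfl, -⟩ | hx
    · simp at h
    · exact (hG x (Finset.mem_insert_of_mem hx)).1

/-! ### Finite Ramsey theory and colorings of pairs -/

/-- The finite Ramsey theorem for graphs. -/
theorem exists_ramsey (a b : ℕ) : ∃ n : ℕ, ∀ {V : Type v} (R : V → V → Prop)
    (_ : ∀ x y, R x y → R y x) (s : Finset V), n ≤ s.card →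
    (∃ t ⊆ s, t.card = a ∧ (t : Set V).Pairwise fun x y => ¬ R x y) ∨
      ∃ t ⊆ s, t.card = b ∧ (t : Set V).Pairwise R := by
  classical
  induction a generalizing b with
  | zero => exact ⟨0, fun R _ s _ => Or.inl ⟨∅, by simp⟩⟩
  | succ a iha =>
  induction b with
  | zero => exact ⟨0, fun R _ s _ => Or.inr ⟨∅, by simp⟩⟩
  | succ b ihb =>
  obtain ⟨n₁, h₁⟩ := iha (b + 1)
  obtain ⟨n₂, h₂⟩ := ihb
  refine ⟨n₁ + n₂ + 1, fun {V} R hR s hs => ?_⟩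
  obtain ⟨v, hv⟩ : s.Nonempty := Finset.card_pos.1 (by omega)
  let sr := (s.erase v).filter (R v)
  let sb := (s.erase v).filter (fun x => ¬ R v x)
  have hsr : sr ⊆ s := (Finset.filter_subset _ _).trans (Finset.erase_subset _ _)
  have hsb : sb ⊆ s := (Finset.filter_subset _ _).trans (Finset.erase_subset _ _)
  have hcard : sr.card + sb.card + 1 = s.card := by
    rw [Finset.card_filter_add_card_filter_not, Finset.card_erase_add_one hv]
  rcases le_or_gt n₁ sb.card with h | h
  · rcases h₁ R hR sb h with ⟨t, ht, htc, hp⟩ | ⟨t, ht, htc, hp⟩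
    · have hvt : v ∉ t := fun h => by simpa [sb] using ht h
      refine Or.inl ⟨insert v t, Finset.insert_subset hv (ht.trans hsb), ?_, ?_⟩
      · rw [Finset.card_insert_of_notMem hvt, htc]
      · rw [Finset.coe_insert]
        refine hp.insert fun x hx _ => ?_
        have := (Finset.mem_filter.1 (ht hx)).2
        exact ⟨this, fun h => this (hR _ _ h)⟩
    · exact Or.inr ⟨t, ht.trans hsb, htc, hp⟩
  · rcases h₂ R hR sr (by omega) with ⟨t, ht, htc, hp⟩ | ⟨t, ht, htc, hp⟩
    · exact Or.inl ⟨t, ht.trans hsr, htc, hp⟩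
    · have hvt : v ∉ t := fun h => by simpa [sr] using ht h
      refine Or.inr ⟨insert v t, Finset.insert_subset hv (ht.trans hsr), ?_, ?_⟩
      · rw [Finset.card_insert_of_notMem hvt, htc]
      · rw [Finset.coe_insert]
        refine hp.insert fun x hx _ => ?_
        have := (Finset.mem_filter.1 (ht hx)).2
        exact ⟨this, hR _ _ this⟩


/-- The pairs of color `1` of a coloring of pairs. -/
def PairRel {δ : Ordinal.{u}} (c : Set.powersetCard (Iio δ) 2 → Fin 2) (x y : Iio δ) : Prop :=
  ∃ s : Set.powersetCard (Iio δ) 2, (s : Finset (Iio δ)) = {x, y} ∧ c s = 1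

section PairRel

variable {δ γ : Ordinal.{u}} {c : Set.powersetCard (Iio δ) 2 → Fin 2} {X : Set (Iio δ)}
  {x y : Iio δ}

theorem PairRel.symm (h : PairRel c x y) : PairRel c y x := by
  obtain ⟨s, hs, hc⟩ := h
  exact ⟨s, by rw [hs, Finset.pair_comm], hc⟩

theorem PairRel.ne (h : PairRel c x y) : x ≠ y := by
  rintro rfl
  obtain ⟨s, hs, -⟩ := h
  have := Set.powersetCard.card_eq s
  simp [hs] at this

theorem ordHomogeneous_one_iff : OrdHomogeneous c X 1 ↔ X.Pairwise (PairRel c) := by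
  classical
  refine ⟨fun h x hx y hy hxy => ?_, fun h s hs => ?_⟩
  · refine ⟨Set.powersetCard.ofCard (Finset.card_pair hxy), rfl, h _ fun z hz => ?_⟩
    rw [Set.powersetCard.val_ofCard] at hz
    rcases Finset.mem_insert.1 hz with rfl | hz
    · exact hx
    · rwa [Finset.mem_singleton.1 hz]
  · obtain ⟨x, y, hxy, hs'⟩ := Finset.card_eq_two.1 (Set.powersetCard.card_eq s)
    obtain ⟨s', hs'', hc⟩ := h (hs x (by simp [hs'])) (hs y (by simp [hs'])) hxy
    rwa [← Subtype.ext (hs''.trans hs'.symm)]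

theorem ordHomogeneous_zero_iff : OrdHomogeneous c X 0 ↔ X.Pairwise fun x y => ¬ PairRel c x y := by
  classical
  refine ⟨fun h x hx y hy hxy => ?_, fun h s hs => ?_⟩
  · rintro ⟨s, hs, hc⟩
    rw [h s fun z hz => ?_] at hc
    · exact zero_ne_one hc
    · rw [hs] at hz
      rcases Finset.mem_insert.1 hz with rfl | hz
      · exact hx
      · rwa [Finset.mem_singleton.1 hz]
  · obtain ⟨x, y, hxy, hs'⟩ := Finset.card_eq_two.1 (Set.powersetCard.card_eq s)
    have := h (hs x (by simp [hs'])) (hs y (by simp [hs'])) hxy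
    by_contra hc
    exact this ⟨s, hs', by omega⟩

theorem pairRel_comp_map {g : Iio γ ↪ Iio δ} {x y : Iio γ} :
    PairRel (fun s => c (Set.powersetCard.map 2 g s)) x y ↔ PairRel c (g x) (g y) := by
  constructor
  · rintro ⟨s, hs, hc⟩
    exact ⟨_, by rw [Set.powersetCard.val_map, hs]; simp, hc⟩
  · rintro ⟨s, hs, hc⟩
    have hne : x ≠ y := fun h => PairRel.ne (c := c) ⟨s, hs, hc⟩ (by rw [h])
    have hs' : Set.powersetCard.map 2 g (Set.powersetCard.ofCard (Finset.card_pair hne)) = s :=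
      Subtype.ext (by rw [hs]; simp)
    exact ⟨Set.powersetCard.ofCard (Finset.card_pair hne), rfl, by rw [← hc, ← hs']⟩

end PairRel

theorem natCard_Iio_natCast (n : ℕ) : Nat.card (Iio (n : Ordinal.{u})) = n := by
  simp [Nat.card, Cardinal.mk_Iio_ordinal]

theorem finite_Iio_natCast (n : ℕ) : Finite (Iio (n : Ordinal.{u})) := by
  rw [← Cardinal.lt_aleph0_iff_finite]
  simp [Cardinal.mk_Iio_ordinal]

theorem nonempty_orderIso_Iio_natCast {P : Type*} [LinearOrder P] [Finite P] {n : ℕ}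
    (h : Nat.card P = n) : Nonempty (P ≃o Iio (n : Ordinal.{u})) := by
  have := Fintype.ofFinite P
  have := finite_Iio_natCast.{u} n
  have := Fintype.ofFinite (Iio (n : Ordinal.{u}))
  rw [Nat.card_eq_fintype_card] at h
  have h' := natCard_Iio_natCast.{u} n
  rw [Nat.card_eq_fintype_card] at h'
  exact ⟨(monoEquivOfFin P h).symm.trans (monoEquivOfFin _ h')⟩

theorem nonempty_homeomorph_Iio_natCast {P : Type*} [TopologicalSpace P] [T1Space P] [Finite P]
    {n : ℕ} (h : Nat.card P = n) : Nonempty (P ≃ₜ Iio (n : Ordinal.{u})) := by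
  have := finite_Iio_natCast.{u} n
  obtain ⟨e⟩ := Finite.card_eq.1 (h.trans (natCard_Iio_natCast.{u} n).symm)
  exact ⟨e.toHomeomorphOfDiscrete⟩

/-- This makes the infimum defining `ordRamsey` attained, and finite. -/
theorem exists_ordArrow_natCast (a b : ℕ) :
    ∃ n : ℕ, OrdArrow.{u} 2 (n : Ordinal.{u}) ![(a : Ordinal.{u}), (b : Ordinal.{u})] := by
  classical
  obtain ⟨n, hn⟩ := exists_ramsey.{u + 1} a b
  refine ⟨n, fun c => ?_⟩
  have := finite_Iio_natCast.{u} n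
  have := Fintype.ofFinite (Iio (n : Ordinal.{u}))
  have hcard : n ≤ (Finset.univ : Finset (Iio (n : Ordinal.{u}))).card := by
    rw [Finset.card_univ, ← Nat.card_eq_fintype_card, natCard_Iio_natCast]
  rcases hn (PairRel c) (fun x y => PairRel.symm) Finset.univ hcard with
    ⟨t, -, ht, hp⟩ | ⟨t, -, ht, hp⟩
  · exact ⟨t, 0, ordHomogeneous_zero_iff.2 hp,
      nonempty_orderIso_Iio_natCast (P := (t : Set (Iio (n : Ordinal.{u})))) (by simpa using ht)⟩
  · exact ⟨t, 1, ordHomogeneous_one_iff.2 hp,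
      nonempty_orderIso_Iio_natCast (P := (t : Set (Iio (n : Ordinal.{u})))) (by simpa using ht)⟩

theorem countable_Iio_of_card_le {o : Ordinal.{u}} (h : o.card ≤ Cardinal.aleph0) :
    (Iio o).Countable := by
  rw [← Cardinal.le_aleph0_iff_set_countable, Cardinal.mk_Iio_ordinal, Cardinal.lift_le_aleph0]
  exact h

/-- A continuous strictly monotone map between linear orders is an embedding. -/
theorem StrictMono.isEmbedding_of_continuous {P Q : Type*} [LinearOrder P] [TopologicalSpace P]
    [OrderTopology P] [LinearOrder Q] [TopologicalSpace Q] [OrderTopology Q] {g : P → Q}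
    (hg : StrictMono g) (hc : Continuous g) : Topology.IsEmbedding g := by
  refine ⟨⟨le_antisymm hc.le_induced ?_⟩, hg.injective⟩
  rw [OrderTopology.topology_eq_generate_intervals (α := P)]
  refine le_generateFrom ?_
  rintro s ⟨a, rfl | rfl⟩
  · exact ⟨Ioi (g a), isOpen_Ioi, by ext; simp [hg.lt_iff_lt]⟩
  · exact ⟨Iio (g a), isOpen_Iio, by ext; simp [hg.lt_iff_lt]⟩

/-! ### The main theorem -/

theorem mainTheorem3 (α β : Ordinal.{u}) (m k : ℕ)
    (hα : α.card ≤ Cardinal.aleph0) (hα0 : α ≠ 0)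
    (hβ : β.card ≤ Cardinal.aleph0) (hβ0 : β ≠ 0)
    (hk : 1 < k)
    (h : OrdArrowCl 2 (ω ^ (ω ^ α)) ![ω ^ β * (m : Ordinal.{u}) + 1, (k : Ordinal.{u})]) :
    OrdArrowTop 2
      (ω ^ (ω ^ α * β) * ordRamsey ![(m : Ordinal.{u}), (k : Ordinal.{u}) + 1] + 1)
      ![ω ^ β * (m : Ordinal.{u}) + 1, (k : Ordinal.{u}) + 1] := by
  classical
  obtain ⟨n, hn⟩ := exists_ordArrow_natCast.{u} m (k + 1)
  rw [Nat.cast_add_one] at hn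
  have hN : OrdArrow 2 (ordRamsey ![(m : Ordinal.{u}), (k : Ordinal.{u}) + 1])
      ![(m : Ordinal.{u}), (k : Ordinal.{u}) + 1] :=
    csInf_mem (s := {b : Ordinal.{u} | OrdArrow 2 b ![(m : Ordinal.{u}), (k : Ordinal.{u}) + 1]})
      ⟨n, hn⟩
  have hNn : ordRamsey ![(m : Ordinal.{u}), (k : Ordinal.{u}) + 1] ≤ n := csInf_le' hn
  set N := ordRamsey ![(m : Ordinal.{u}), (k : Ordinal.{u}) + 1]
  set δ := ω ^ (ω ^ α * β) * N + 1 with hδdef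
  have hωα : (ω ^ α).card ≤ Cardinal.aleph0 := (card_opow_le _ _).trans (by simp [hα])
  have hδc : (Iio δ).Countable := by
    refine countable_Iio_of_card_le ?_
    have h1 : (ω ^ α * β).card ≤ Cardinal.aleph0 := by
      rw [card_mul]
      exact (mul_le_mul' hωα hβ).trans_eq Cardinal.aleph0_mul_aleph0
    have h2 : (ω ^ (ω ^ α * β)).card ≤ Cardinal.aleph0 := (card_opow_le _ _).trans (by simpa using h1)
    have h3 : N.card ≤ Cardinal.aleph0 := (card_le_card hNn).trans (by simp)
    rw [card_add, card_mul, card_one]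
    exact (add_le_add (mul_le_mul' h2 h3) Cardinal.one_le_aleph0).trans (by simp)
  intro c
  by_cases hK : ∃ X : Set (Iio δ), X.Pairwise (PairRel c) ∧ Nat.card X = k + 1
  · obtain ⟨X, hX, hcard⟩ := hK
    have : Finite X := Nat.finite_of_card_ne_zero (by omega)
    refine ⟨X, 1, ordHomogeneous_one_iff.2 hX, ?_⟩
    have := nonempty_homeomorph_Iio_natCast.{u} hcard
    rwa [Nat.cast_add_one] at this
  by_contra hcon
  have h0 : ∀ X : Set (Iio δ), X.Pairwise (fun x y => ¬ PairRel c x y) →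
      IsEmpty (X ≃ₜ Iio (ω ^ β * (m : Ordinal.{u}) + 1)) := fun X hX => by
    by_contra hne
    exact hcon ⟨X, 0, ordHomogeneous_zero_iff.2 hX, not_isEmpty_iff.1 hne⟩
  let R : Ordinal.{u} → Ordinal.{u} → Prop := fun x y =>
    ∃ (hx : x < δ) (hy : y < δ), PairRel c ⟨x, hx⟩ ⟨y, hy⟩
  have hsmall : ∀ z < δ, CBRankLT {x | x < δ ∧ R z x} (ω ^ α) := by
    intro z hz
    by_contra hlarge
    obtain ⟨f, y, x, hf⟩ := exists_isClosedCopy_of_not_cbRankLT hα0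
      (countable_Iio_of_card_le hωα) hδc (fun _ h => h.1) hlarge
    have hlim : Order.IsSuccLimit (ω ^ ω ^ α) :=
      isSuccLimit_opow_left isSuccLimit_omega0 (opow_pos α omega0_pos).ne'
    have hmem : ∀ ζ < ω ^ ω ^ α, 1 + ζ ∈ Ioo 0 (ω ^ ω ^ α) := fun ζ hζ =>
      ⟨zero_lt_one.trans_le le_self_add,
        isPrincipal_add_omega0_opow _ (one_lt_opow.2 ⟨one_lt_omega0, (opow_pos α omega0_pos).ne'⟩) hζ⟩
    have hfδ : ∀ ζ < ω ^ ω ^ α, f (1 + ζ) < δ := fun ζ hζ => (hf.mem _ (hmem ζ hζ)).1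
    have hmono := hf.strictMono (fun ζ hζ => (hmem ζ hζ).2.le) hfδ
    have hemb := hmono.isEmbedding_of_continuous
      (hf.continuous (fun ζ hζ => (hmem ζ hζ).2.le) hfδ)
    let g : Iio (ω ^ ω ^ α) ↪ Iio δ := ⟨_, hmono.injective⟩
    have hgz : ∀ ζ, PairRel c ⟨z, hz⟩ (g ζ) := fun ζ => by
      obtain ⟨_, _, _, hR⟩ := hf.mem _ (hmem ζ ζ.2)
      exact hR
    -- The coloring is pulled back along the topological embedding `g`, so a color-0 copy found
    -- there remains a homeomorphic copy in `δ`.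
    obtain ⟨X, i, hX, e, he⟩ := h fun s => c (Set.powersetCard.map 2 g s)
    match i with
    | 0 =>
      have hX' : (g '' X).Pairwise fun x y => ¬ PairRel c x y := by
        rintro _ ⟨a, ha, rfl⟩ _ ⟨b, hb, rfl⟩ hab
        rw [← pairRel_comp_map]
        exact ordHomogeneous_zero_iff.1 hX ha hb (fun h => hab (by rw [h]))
      exact (h0 _ hX').false ((hemb.homeomorphImage X).symm.trans he.homeomorph)
    | 1 =>
      refine hK ⟨insert ⟨z, hz⟩ (g '' X), ?_, ?_⟩
      · refine Set.Pairwise.insert ?_ ?_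
        · rintro _ ⟨a, ha, rfl⟩ _ ⟨b, hb, rfl⟩ hab
          rw [← pairRel_comp_map]
          exact ordHomogeneous_one_iff.1 hX ha hb (fun h => hab (by rw [h]))
        · rintro _ ⟨a, ha, rfl⟩ -
          exact ⟨hgz a, (hgz a).symm⟩
      · have hXc : Nat.card X = k :=
          (Nat.card_congr e.toEquiv).trans (natCard_Iio_natCast k)
        have hXf : X.Finite := Nat.finite_of_card_ne_zero (α := X) (by omega)
        rw [Nat.card_coe_set_eq] at hXc ⊢
        rw [Set.ncard_insert_of_notMem ?_ (hXf.image _),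
          Set.ncard_image_of_injective _ g.injective, hXc]
        · rintro ⟨a, -, ha⟩
          exact (hgz a).ne ha.symm
  have hpos : 0 < ω ^ (ω ^ α * β) := opow_pos _ omega0_pos
  -- The shift `i + 1` avoids the point `0`, which has rank `0`; the final `+ 1` in `δ` makes room
  -- for the last multiple.
  have hp : ∀ i : Iio N, ω ^ (ω ^ α * β) * (i + 1) < δ := fun i => by
    refine (mul_le_mul_right (Order.add_one_le_of_lt i.2) _).trans_lt ?_
    exact lt_add_one _
  let p : Iio N ↪ Iio δ := ⟨fun i => ⟨ω ^ (ω ^ α * β) * (i + 1), hp i⟩, fun i j hij => by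
    have := mul_left_cancel₀ hpos.ne' (Subtype.ext_iff.1 hij)
    exact Subtype.ext (by simpa using this)⟩
  obtain ⟨X, i, hX, ⟨e⟩⟩ := hN fun s => c (Set.powersetCard.map 2 p s)
  match i with
  | 1 =>
    refine hK ⟨p '' X, ?_, ?_⟩
    · rintro _ ⟨a, ha, rfl⟩ _ ⟨b, hb, rfl⟩ hab
      rw [← pairRel_comp_map]
      exact ordHomogeneous_one_iff.1 hX ha hb (fun h => hab (by rw [h]))
    · have hXc := Nat.card_congr e.toEquiv
      rw [Nat.card_coe_set_eq, Set.ncard_image_of_injective _ p.injective, ← Nat.card_coe_set_eq,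
        hXc, ← natCard_Iio_natCast.{u} (k + 1), Nat.cast_add_one]
      rfl
  | 0 =>
    have hXc : Nat.card X = m := (Nat.card_congr e.toEquiv).trans (natCard_Iio_natCast m)
    have : Finite X := Finite.of_equiv (h := finite_Iio_natCast.{u} m) _ e.symm.toEquiv
    -- For `m = 0` the target is a single point, and `G` is empty and supplies no maximum.
    rcases Nat.eq_zero_or_pos m with rfl | hm
    · have hδ0 : (0 : Ordinal.{u}) ∈ Iio δ := by
        rw [mem_Iio, hδdef]
        exact Order.lt_add_one_iff.2 zero_le
      refine (h0 {⟨0, hδ0⟩} (Set.pairwise_singleton _ _)).false ?_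
      have := nonempty_homeomorph_Iio_natCast.{u} (n := 1)
        (P := ({⟨0, hδ0⟩} : Set (Iio δ))) (by simp)
      rw [show ω ^ β * ((0 : ℕ) : Ordinal.{u}) + 1 = ((1 : ℕ) : Ordinal.{u}) by simp]
      exact this.some
    let q : X → Ordinal.{u} := fun i => p i
    have hq : Function.Injective q := Subtype.val_injective.comp (p.injective.comp
      Subtype.val_injective)
    let G : Finset Ordinal.{u} := (Set.finite_range q).toFinset
    have hGm : G.card = m := by
      rw [← Set.ncard_coe_finset, Set.Finite.coe_toFinset, ← Set.image_univ,
        Set.ncard_image_of_injective _ hq, Set.ncard_univ, hXc]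
    have hGδ : (G : Set Ordinal.{u}) ⊆ Iio δ := by
      rw [Set.Finite.coe_toFinset]
      rintro _ ⟨i, rfl⟩
      exact (p i).2
    have hGp : (G : Set Ordinal.{u}).Pairwise fun x y => ¬ R x y := by
      rw [Set.Finite.coe_toFinset]
      rintro _ ⟨i, rfl⟩ _ ⟨j, rfl⟩ hij ⟨_, _, hR⟩
      exact ordHomogeneous_zero_iff.1 hX i.2 j.2 (fun h => hij (by simp only [q, h]))
        (pairRel_comp_map.2 hR)
    obtain ⟨Y, hGY, hYδ, hYp, hY⟩ := exists_superset_cbDeriv hδc (countable_Iio_of_card_le hβ) hα0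
      (fun x y ⟨hx, hy, hR⟩ => ⟨hy, hx, hR.symm⟩) hsmall G hGδ hGp
    obtain ⟨f, x, hf, hx⟩ := exists_isClosedCopy_of_finset (Y := Y) hβ0
      (countable_Iio_of_card_le hβ) (fun y hy => hδc.mono (Iio_subset_Iio (hYδ hy).le)) G
      (fun g hg => by
        refine ⟨hGY hg, hY β le_rfl g (hGY hg) ?_⟩
        obtain ⟨i, rfl⟩ := (Set.Finite.mem_toFinset _).1 hg
        exact mem_cbDeriv_of_dvd (mul_ne_zero hpos.ne' (by simp)) (p i).2.le (dvd_mul_right _ _))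
    rw [hGm] at hf
    have hxG : x ∈ G := by
      rcases hx with ⟨h, -⟩ | hx
      · rw [h] at hGm
        simp at hGm
        omega
      · exact hx
    -- As `ω ^ β * m` is infinite, it absorbs `1` on the left, so `ζ ↦ 1 + ζ` maps `ω ^ β * m + 1`
    -- onto the index interval `(0, ω ^ β * m]`.
    have hω : ω ≤ ω ^ β * (m : Ordinal.{u}) :=
      (left_le_opow ω (pos_iff_ne_zero.2 hβ0)).trans
        (le_mul_of_one_le_right' (by exact_mod_cast hm))
    have hle : ∀ ζ < ω ^ β * (m : Ordinal.{u}) + 1, 1 + ζ ≤ ω ^ β * (m : Ordinal.{u}) :=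
      fun ζ hζ => by
        rw [← one_add_of_omega0_le hω]
        gcongr
        exact Order.lt_add_one_iff.1 hζ
    have hfY : ∀ ζ < ω ^ β * (m : Ordinal.{u}) + 1, f (1 + ζ) ∈ Y := fun ζ hζ => by
      rcases (hle ζ hζ).eq_or_lt with h | h
      · rw [h, hf.apply_last]
        exact hGY hxG
      · exact hf.mem _ ⟨zero_lt_one.trans_le le_self_add, h⟩
    have hfδ := fun ζ hζ => hYδ (hfY ζ hζ)
    have hemb := (hf.strictMono hle hfδ).isEmbedding_of_continuous (hf.continuous hle hfδ)
    refine (h0 _ ?_).false hemb.toHomeomorph.symm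
    rintro _ ⟨i, rfl⟩ _ ⟨j, rfl⟩ hij hR
    exact hYp (hfY i i.2) (hfY j j.2) (fun h => hij (Subtype.ext h)) ⟨_, _, hR⟩
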